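/- A class $\mathcal{K}$ of groups that is closed under isomorphism and contains at least one non-identity group is called a root-class if it satisfies the following conditions. 1. If $A \in \mathcal{K}$ and $B \leqslant A$, then $B \in \mathcal{K}$. 2. If $A, B \in \mathcal{K}$, then $A \times B \in \mathcal{K}$. 3. If $C \trianglelefteq B \trianglelefteq A$ and $A/B, B/C \in \mathcal{K}$, then there is a normal subgroup $D$ of $A$ such that $D \leqslant C$ and $A/D \in \mathcal{K}$. A group $G$ is called $\mathcal{K}$-residual if for every element $g \neq 1$ of $G$ there is a homomorphism $\varphi$ from $G$ to some group $G' \in \mathcal{K}$ with $\varphi(g) \neq 1$. **Theorem.** Let $\mathcal{K}$ be a root-class and let $(G_i)_{i \in I}$ be any family (finite or infinite) of $\mathcal{K}$-residual groups. Then the free product of the groups $G_i$, $i \in I$, is $\mathcal{K}$-residual. -/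

import Mathlib

universe u v

/-- A root-class: a class `K` of groups (of a universe `Type u`) that is closed under isomorphism,
contains a group with more than one element, is closed under subgroups and under direct products of
two factors, and has the following property: whenever `C ⊴ B ⊴ A` with `A ⧸ B` and `B ⧸ C` in `K`,
there is a normal subgroup `D` of `A` with `D ≤ C` and `A ⧸ D` in `K`. -/
structure IsRootClass (K : ∀ (G : Type u) [Group G], Prop) : Prop where
  /-- `K` is an abstract class: it is closed under isomorphism. -/
  of_mulEquiv : ∀ (A B : Type u) [Group A] [Group B], Nonempty (A ≃* B) → K A → K B
  /-- `K` contains a non-identity group. -/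
  exists_nontrivial : ∃ (A : Type u) (_ : Group A), Nontrivial A ∧ K A
  /-- `K` is closed under subgroups. -/
  subgroup : ∀ (A : Type u) [Group A] (B : Subgroup A), K A → K B
  /-- `K` is closed under direct products of two groups. -/
  prod : ∀ (A B : Type u) [Group A] [Group B], K A → K B → K (A × B)
  /-- The root property. A subgroup `C` of `B` is regarded as a subgroup of `A` through
  `C.map B.subtype`. -/
  root : ∀ (A : Type u) [Group A] (B : Subgroup A) [B.Normal] (C : Subgroup B) [C.Normal],
    K (A ⧸ B) → K (B ⧸ C) →
      ∃ (D : Subgroup A) (_ : D.Normal), D ≤ C.map B.subtype ∧ K (A ⧸ D)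

/-- The group `G` is `K`-residual: every non-identity element of `G` is sent to a non-identity
element by some homomorphism from `G` to a group of the class `K`. -/
def IsResidual (K : ∀ (G : Type u) [Group G], Prop) (G : Type v) [Group G] : Prop :=
  ∀ g : G, g ≠ 1 → ∃ (G' : Type u) (_ : Group G') (φ : G →* G'), K G' ∧ φ g ≠ 1

/-! Induct on the length of a reduced word. If its end letters share a factor, conjugation shortens
it. Otherwise one `π` to some `P` in `K` keeps all non-empty proper prefixes nontrivial. Conjugating
the factors separately lifts `π` to `C ≀ᵣ P`, which is in `K` by `regularWreathProduct`; a twist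
supported at `1 : P` on the first letter's factor makes the coordinate at `1` of the word equal to a
chosen `c ≠ 1`. -/

/-- The element `g` of a group is sent to a non-identity element by some homomorphism to a group
of the class `K`. -/
def IsSeparatedBy (K : ∀ (G : Type u) [Group G], Prop) {G : Type v} [Group G] (g : G) : Prop :=
  ∃ (G' : Type u) (_ : Group G') (φ : G →* G'), K G' ∧ φ g ≠ 1

namespace IsSeparatedBy

variable {K : ∀ (G : Type u) [Group G], Prop}

theorem of_map {G : Type v} [Group G] {H : Type*} [Group H] (φ : G →* H) {g : G}
    (h : IsSeparatedBy K (φ g)) : IsSeparatedBy K g := by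
  obtain ⟨A, _, ψ, hA, hψ⟩ := h
  exact ⟨A, _, ψ.comp φ, hA, hψ⟩

theorem of_conj {G : Type v} [Group G] (x : G) {g : G} (h : IsSeparatedBy K (x * g * x⁻¹)) :
    IsSeparatedBy K g :=
  h.of_map (MulAut.conj x).toMonoidHom

end IsSeparatedBy

namespace IsRootClass

variable {K : ∀ (G : Type u) [Group G], Prop}

/-- A root-class is closed under regular wreath products. -/
theorem regularWreathProduct (hK : IsRootClass K) {D Q : Type u} [Group D] [Group Q]
    (hD : K D) (hQ : K Q) : K (D ≀ᵣ Q) := by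
  let B : Subgroup (D ≀ᵣ Q) := RegularWreathProduct.rightHom.ker
  have hB : ∀ b : B, (b : D ≀ᵣ Q).right = 1 := fun b => b.2
  let ε : B →* D :=
    { toFun := fun b => (b : D ≀ᵣ Q).left 1
      map_one' := rfl
      map_mul' := fun a b => by simp [hB a] }
  have hr : Function.Surjective (RegularWreathProduct.rightHom : D ≀ᵣ Q →* Q) :=
    fun q => ⟨RegularWreathProduct.inl q, rfl⟩
  have hε : Function.Surjective ε := fun d => ⟨⟨⟨fun _ => d, 1⟩, rfl⟩, rfl⟩
  obtain ⟨N, hN, hNC, hKN⟩ := hK.root (D ≀ᵣ Q) B ε.ker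
    (hK.of_mulEquiv _ _ ⟨(QuotientGroup.quotientKerEquivOfSurjective _ hr).symm⟩ hQ)
    (hK.of_mulEquiv _ _ ⟨(QuotientGroup.quotientKerEquivOfSurjective _ hε).symm⟩ hD)
  have key : ∀ n ∈ N, n.right = 1 ∧ n.left 1 = 1 := by
    intro n hn
    obtain ⟨b, hb, rfl⟩ := hNC hn
    exact ⟨hB b, hb⟩
  have hbot : N = ⊥ := by
    rw [eq_bot_iff]
    intro n hn
    have h1 := (key n hn).1
    refine RegularWreathProduct.ext (funext fun q => ?_) h1
    -- Conjugation by `q⁻¹` moves coordinate `q` to coordinate `1`, where elements of `N` vanish.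
    have h2 := (key _ (hN.conj_mem n hn (RegularWreathProduct.inl q⁻¹))).2
    simpa [h1] using h2
  subst hbot
  exact hK.of_mulEquiv _ _ ⟨QuotientGroup.quotientBot⟩ hKN

/-- Finitely many separated elements are separated by a single homomorphism. -/
theorem exists_forall_ne_one (hK : IsRootClass K) {G : Type v} [Group G] (L : List G)
    (hL : ∀ g ∈ L, IsSeparatedBy K g) :
    ∃ (P : Type u) (_ : Group P) (π : G →* P), K P ∧ ∀ g ∈ L, π g ≠ 1 := by
  induction L with
  | nil =>
    obtain ⟨A, _, -, hA⟩ := hK.exists_nontrivial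
    exact ⟨A, _, 1, hA, by simp⟩
  | cons a L ih =>
    obtain ⟨P, _, π, hP, hπ⟩ := ih fun g hg => hL g (List.mem_cons_of_mem _ hg)
    obtain ⟨A, _, ψ, hA, hψ⟩ := hL a List.mem_cons_self
    refine ⟨P × A, _, π.prod ψ, hK.prod _ _ hP hA, ?_⟩
    intro g hg
    rcases List.mem_cons.1 hg with rfl | hg
    · exact fun h => hψ (congrArg Prod.snd h)
    · exact fun h => hπ g hg (congrArg Prod.fst h)

end IsRootClass

namespace Monoid.CoprodI

section Twist

variable {ι : Type*} {G : ι → Type*} [∀ i, Group (G i)] {C P : Type*} [Group C] [Group P]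

/-- The lift of a homomorphism `π : CoprodI G →* P` to the wreath product `C ≀ᵣ P` in which the
free factor `G i` is conjugated by the function `f i : P → C`. -/
def twist (π : CoprodI G →* P) (f : ι → P → C) : CoprodI G →* C ≀ᵣ P :=
  lift fun i => ((MulAut.conj (⟨f i, 1⟩ : C ≀ᵣ P)).toMonoidHom.comp
    RegularWreathProduct.inl).comp (π.comp of)

theorem twist_right (π : CoprodI G →* P) (f : ι → P → C) (g : CoprodI G) :
    (twist π f g).right = π g := by
  have : (RegularWreathProduct.rightHom).comp (twist π f) = π := by
    ext i x
    simp [twist]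
  exact DFunLike.congr_fun this g

theorem twist_left_of (π : CoprodI G →* P) (f : ι → P → C) {i : ι} (a : G i) (q : P) :
    (twist π f (of a)).left q = f i q * (f i ((π (of a))⁻¹ * q))⁻¹ := by
  simp [twist]

/-- Each letter contributes values of its own `f i` only at the inverse images of the prefixes just
before and just after it. -/
theorem twist_left_mul_of (π : CoprodI G →* P) (f : ι → P → C) (g : CoprodI G) {i : ι} (a : G i) :
    (twist π f (g * of a)).left 1 =
      (twist π f g).left 1 * (f i (π g)⁻¹ * (f i (π (g * of a))⁻¹)⁻¹) := by
  simp [twist_left_of, twist_right]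

/-- The product in the free product of a list of letters. -/
def wordProd (l : List (Σ i, G i)) : CoprodI G := (l.map fun x => of x.2).prod

@[simp]
theorem wordProd_cons (x : Σ i, G i) (l : List (Σ i, G i)) :
    wordProd (x :: l) = of x.2 * wordProd l := by
  simp [wordProd]

@[simp]
theorem wordProd_append (l m : List (Σ i, G i)) :
    wordProd (l ++ m) = wordProd l * wordProd m := by
  simp [wordProd]

@[simp]
theorem wordProd_nil : wordProd ([] : List (Σ i, G i)) = 1 := rfl

open Classical in
/-- The twisting functions that are trivial except for the value `c` at `(i, 1)`. -/
noncomputable def delta (P : Type*) [Group P] (i : ι) (c : C) (j : ι) : P → C :=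
  if j = i then Pi.mulSingle 1 c else 1

theorem delta_self (i : ι) (c : C) : delta P i c i 1 = c := by
  simp [delta]

theorem delta_of_ne_one (i j : ι) (c : C) {p : P} (hp : p ≠ 1) : delta P i c j p = 1 := by
  unfold delta
  split_ifs
  · simp [hp]
  · rfl

theorem delta_of_ne {i j : ι} (h : j ≠ i) (c : C) (p : P) : delta P i c j p = 1 := by
  simp [delta, h]

/-- Only the empty prefix maps to `1`, so the sole nontrivial contribution is the `c` from the start
of the first letter. -/
theorem twist_delta_left (π : CoprodI G →* P) (c : C) (x : Σ i, G i) (l : List (Σ i, G i))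
    (h : ∀ q, q <+: l → π (wordProd (x :: q)) ≠ 1) :
    (twist π (delta P x.1 c) (wordProd (x :: l))).left 1 = c := by
  induction l using List.reverseRecOn with
  | nil =>
    have hx : π (of x.2) ≠ 1 := by simpa using h [] (List.prefix_rfl)
    simp [twist_left_of, delta_self, delta_of_ne_one, hx]
  | append_singleton l y ih =>
    have h1 := ih fun q hq => h q (hq.trans (List.prefix_append _ _))
    have h2 := h l (List.prefix_append _ _)
    have h3 := h _ List.prefix_rfl
    have e : wordProd (x :: (l ++ [y])) = wordProd (x :: l) * of y.2 := by simp [mul_assoc]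
    rw [e] at h3 ⊢
    rw [twist_left_mul_of, h1, delta_of_ne_one _ _ _ (inv_ne_one.2 h2),
      delta_of_ne_one _ _ _ (inv_ne_one.2 h3)]
    simp

end Twist

section Separation

variable {K : ∀ (G : Type u) [Group G], Prop} {ι : Type v} {G : ι → Type u} [∀ i, Group (G i)]

theorem isSeparatedBy_of {i : ι} (hG : IsResidual.{u, u} K (G i)) {a : G i} (ha : a ≠ 1) :
    IsSeparatedBy K (of a : CoprodI G) := by
  classical
  refine IsSeparatedBy.of_map (lift (Pi.mulSingle i (MonoidHom.id (G i)))) ?_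
  rw [of_leftInverse]
  exact hG a ha

/-- A word whose first and last letters come from different factors and whose non-empty proper
prefixes are separated is separated itself. -/
theorem isSeparatedBy_of_prefixes (hK : IsRootClass K) (x y : Σ i, G i) (hxy : y.1 ≠ x.1)
    (l : List (Σ i, G i)) (h : ∀ q, q <+: l → IsSeparatedBy K (wordProd (x :: q))) :
    IsSeparatedBy K (wordProd (x :: (l ++ [y]))) := by
  obtain ⟨C, _, hC, hKC⟩ := hK.exists_nontrivial
  obtain ⟨c, hc⟩ := exists_ne (1 : C)
  obtain ⟨P, _, π, hP, hπ⟩ := hK.exists_forall_ne_one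
    (l.inits.map fun q => wordProd (x :: q)) (by simpa using h)
  refine ⟨C ≀ᵣ P, _, twist π (delta P x.1 c), hK.regularWreathProduct hKC hP, fun h1 => hc ?_⟩
  have e : wordProd (x :: (l ++ [y])) = wordProd (x :: l) * of y.2 := by simp [mul_assoc]
  have h2 := congrFun (congrArg RegularWreathProduct.left h1) 1
  -- The twist on the factor of `y` is trivial everywhere, so `π` may kill the whole word.
  rw [e, twist_left_mul_of, twist_delta_left, delta_of_ne hxy, delta_of_ne hxy] at h2
  · simpa using h2
  · intro q hq
    exact hπ _ (List.mem_map.2 ⟨q, (List.mem_inits _ _).2 hq, rfl⟩)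

theorem isSeparatedBy_wordProd (hK : IsRootClass K) (hG : ∀ i, IsResidual.{u, u} K (G i))
    (w : List (Σ i, G i)) (hw : w ≠ []) (h1 : ∀ x ∈ w, x.2 ≠ 1)
    (hc : w.IsChain fun x y => x.1 ≠ y.1) : IsSeparatedBy K (wordProd w) := by
  induction hn : w.length using Nat.strong_induction_on generalizing w with
  | _ n ih =>
  subst hn
  obtain ⟨x, w, rfl⟩ := List.exists_cons_of_ne_nil hw
  rcases List.eq_nil_or_concat w with rfl | ⟨l, y, rfl⟩
  · simpa using isSeparatedBy_of (hG x.1) (h1 x (by simp))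
  rw [List.concat_eq_append] at *
  by_cases hxy : y.1 = x.1
  · obtain ⟨i, a⟩ := x
    obtain ⟨j, b⟩ := y
    obtain rfl : j = i := hxy
    have hl : l ≠ [] := by
      rintro rfl
      simp at hc
    have hcl : List.IsChain (fun x y : Σ i, G i => x.1 ≠ y.1) (l ++ [⟨j, b * a⟩]) := by
      have := hc.tail
      rw [List.tail_cons, List.isChain_append] at this
      rw [List.isChain_append]
      simpa using this
    refine IsSeparatedBy.of_conj (of a)⁻¹ ?_
    have e : (of a)⁻¹ * wordProd (⟨j, a⟩ :: (l ++ [⟨j, b⟩])) * ((of a)⁻¹)⁻¹ =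
        wordProd (l ++ [⟨j, b * a⟩]) := by
      simp [mul_assoc]
    rw [e]
    -- If the merged letter cancels, `l` remains, which is reduced and non-empty.
    by_cases hba : b * a = 1
    · have e' : wordProd (l ++ [⟨j, b * a⟩]) = wordProd l := by simp [hba]
      rw [e']
      exact ih l.length (by simp) l hl (fun z hz => h1 z (by simp [hz]))
        hcl.left_of_append rfl
    · refine ih _ (by simp) _ (by simp) ?_ hcl rfl
      intro z hz
      rcases List.mem_append.1 hz with hz | hz
      · exact h1 z (by simp [hz])
      · obtain rfl := List.mem_singleton.1 hz
        exact hba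
  · refine isSeparatedBy_of_prefixes hK x y hxy l fun q hq => ?_
    have hp : x :: q <+: x :: (l ++ [y]) :=
      (List.cons_prefix_cons).2 ⟨rfl, hq.trans (List.prefix_append _ _)⟩
    refine ih _ ?_ _ (by simp) (fun z hz => h1 z (hp.subset hz)) (hc.prefix hp) rfl
    have := hq.length_le
    simp
    omega

end Separation

end Monoid.CoprodI

theorem theorem2 (K : ∀ (G : Type u) [Group G], Prop) (hK : IsRootClass.{u} K)
    {ι : Type v} (G : ι → Type u) [∀ i, Group (G i)]
    (hG : ∀ i, IsResidual.{u, u} K (G i)) :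
    IsResidual.{u, max v u} K (Monoid.CoprodI G) := by
  classical
  intro g hg
  let w := Monoid.CoprodI.Word.equiv g
  have hw : w.prod = g := Monoid.CoprodI.Word.equiv.symm_apply_apply g
  have := Monoid.CoprodI.isSeparatedBy_wordProd hK hG w.toList ?_ w.ne_one w.chain_ne
  · rw [← hw]
    exact this
  · intro h
    apply hg
    rw [← hw, Monoid.CoprodI.Word.prod, h]
    rfl
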